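/- Let $K$ be an imaginary quadratic field with ring of integers $\mathcal{O}_K$ and discriminant $D_K$. Let $c\ge 1$ be an odd integer and let $d\geq 0$ be an integer. Let $\mathcal{O}_0=\mathbf{Z}+c\,\mathcal{O}_K$ and $\mathcal{O}_d=\mathbf{Z}+2^d c\,\mathcal{O}_K$ be the orders in $K$ of conductor $c$ and $2^d c$. For an order $\mathcal{O}$, let $\operatorname{Cl}(\mathcal{O})$ be the group of invertible fractional $\mathcal{O}$-ideals modulo principal ones. Let $S_d$ and $S_0$ be the Sylow $2$-subgroups of $\operatorname{Cl}(\mathcal{O}_d)$ and $\operatorname{Cl}(\mathcal{O}_0)$. Let $\varphi_d\colon S_d\to S_0$ be the restriction of the natural homomorphism $\operatorname{Cl}(\mathcal{O}_d)\to\operatorname{Cl}(\mathcal{O}_0)$, $[\mathfrak{a}]\mapsto[\mathfrak{a}\mathcal{O}_0]$, and let $\kappa_d=\ker\varphi_d$. Consider the sequence $$1\to\kappa_d\to S_d\xrightarrow{\;\varphi_d\;}S_0\to 1.\qquad(*)$$ (a) Suppose $2$ is split or inert in $\mathcal{O}_0$. If $d\leq 3$, or if $d>3$ and $\operatorname{Cl}(\mathcal{O}_0)$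 has no elements of order $4$, then $(*)$ is a split short exact sequence. (b) Suppose $2$ is ramified in $\mathcal{O}_0$ and $D_K\equiv 8 \pmod{16}$. If $d\leq 1$, or if $d>1$ and $\operatorname{Cl}(\mathcal{O}_0)$ has no elements of order $4$, then $(*)$ is a split short exact sequence. Here $2$ is split, inert or ramified in $\mathcal{O}_0$ if $2\mathcal{O}_0$ is, respectively, the product of two distinct prime ideals, a prime ideal, or the square of a prime ideal. -/

import Mathlib

open scoped NumberField

noncomputable section

namespace QuadraticOrder

/-- The order `ℤ + c 𝓞_K` of conductor `c` in (the ring of integers of) `K`. -/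
def order (K : Type*) [Field K] (c : ℕ) : Subring (𝓞 K) where
  carrier := {x | ∃ (a : ℤ) (y : 𝓞 K), x = (a : 𝓞 K) + (c : 𝓞 K) * y}
  mul_mem' := by
    rintro _ _ ⟨a, y, rfl⟩ ⟨b, z, rfl⟩
    exact ⟨a * b, a * z + b * y + c * y * z, by push_cast; ring⟩
  one_mem' := ⟨1, 0, by simp⟩
  add_mem' := by
    rintro _ _ ⟨a, y, rfl⟩ ⟨b, z, rfl⟩
    exact ⟨a + b, y + z, by push_cast; ring⟩
  zero_mem' := ⟨0, 0, by simp⟩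
  neg_mem' := by
    rintro _ ⟨a, y, rfl⟩
    exact ⟨-a, -y, by push_cast; ring⟩

theorem order_le_order (K : Type*) [Field K] {m n : ℕ} (h : m ∣ n) : order K n ≤ order K m := by
  obtain ⟨k, rfl⟩ := h
  rintro _ ⟨a, y, rfl⟩
  exact ⟨a, k * y, by push_cast; ring⟩

/-- For `m ∣ n`, the natural homomorphism `Cl(ℤ + n 𝓞_K) → Cl(ℤ + m 𝓞_K)`, given by extension
of invertible fractional ideals along the inclusion `ℤ + n 𝓞_K ⊆ ℤ + m 𝓞_K`. -/
def classGroupMap (K : Type*) [Field K] {m n : ℕ} (h : m ∣ n) :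
    ClassGroup (order K n) →* ClassGroup (order K m) :=
  letI : Algebra (order K n) (order K m) := (Subring.inclusion (order_le_order K h)).toAlgebra
  haveI : Module.IsTorsionFree (order K n) (order K m) :=
    Module.isTorsionFree_iff_algebraMap_injective.2 (Subring.inclusion_injective _)
  ClassGroup.extendedHom (order K n) (order K m)

/-- The Sylow `ℓ`-subgroup `Cl(ℤ + n 𝓞_K)[ℓ^∞]` of the class group of the order of
conductor `n` (for a prime `ℓ`), consisting of the classes of `ℓ`-power order. -/
abbrev sylowPart (K : Type*) [Field K] (ℓ : ℕ) (n : ℕ) :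
    Subgroup (ClassGroup (order K n)) :=
  CommGroup.primaryComponent (ClassGroup (order K n)) ℓ

/-- The restriction `φ_d : S_d → S_0` to Sylow `ℓ`-subgroups of the natural homomorphism
`Cl(O_d) → Cl(O_0)`, where `O_0` and `O_d` have conductors `c` and `c ℓ^d`. -/
def phi (K : Type*) [Field K] (ℓ : ℕ) (c d : ℕ) :
    sylowPart K ℓ (c * ℓ ^ d) →* sylowPart K ℓ c :=
  ((classGroupMap K (Dvd.intro (ℓ ^ d) rfl)).comp
    (sylowPart K ℓ (c * ℓ ^ d)).subtype).codRestrict (sylowPart K ℓ c) (by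
      rintro ⟨x, k, hk⟩
      exact ⟨k, by simp [← map_pow, hk]⟩)

/-- The kernel `κ_d` of `φ_d : S_d → S_0`. -/
abbrev kappa (K : Type*) [Field K] (ℓ : ℕ) (c d : ℕ) :
    Subgroup (sylowPart K ℓ (c * ℓ ^ d)) :=
  (phi K ℓ c d).ker

/-- The sequence `1 → κ_d → S_d → S_0 → 1` (inclusion, then `φ_d`) is a short exact sequence,
and it is split. -/
def IsSplitSES (K : Type*) [Field K] (ℓ : ℕ) (c d : ℕ) : Prop :=
  ∃ E : GroupExtension (kappa K ℓ c d) (sylowPart K ℓ (c * ℓ ^ d)) (sylowPart K ℓ c),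
    E.inl = (kappa K ℓ c d).subtype ∧ E.rightHom = phi K ℓ c d ∧ Nonempty E.Splitting

/-- `p` is split in `R`: `pR` is a product of two distinct prime ideals. -/
def IsSplitIn (p : ℕ) (R : Type*) [CommRing R] : Prop :=
  ∃ P Q : Ideal R, P.IsPrime ∧ Q.IsPrime ∧ P ≠ Q ∧ Ideal.span {(p : R)} = P * Q

/-- `p` is inert in `R`: `pR` is a prime ideal. -/
def IsInertIn (p : ℕ) (R : Type*) [CommRing R] : Prop :=
  (Ideal.span {(p : R)}).IsPrime

/-- `p` is ramified in `R` (an order of a quadratic field): `pR` is the square of a prime ideal. -/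
def IsRamifiedIn (p : ℕ) (R : Type*) [CommRing R] : Prop :=
  ∃ P : Ideal R, P.IsPrime ∧ Ideal.span {(p : R)} = P ^ 2

end QuadraticOrder

end

namespace QuadraticOrder

open QuadraticAlgebra
open scoped nonZeroDivisors

/-! Write R ⊆ T for the two orders. The splitting rests on one property of `φ_d`: a square of S_d
lying in the kernel is already the square of a kernel element (`exists_mem_ker_sq_eq`). With it,
`exists_section` gives a section as soon as κ_d or S_0 has exponent two.

Since 2^d T ⊆ R, extension and contraction match the ideals of R and T that contain an odd integer,
and every class has such a representative. A kernel class thus comes from an ideal of R whose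
extension is (β) with N(β) odd, and its m-th power is trivial when β^m ∈ R. In coordinates, β^6 has
imaginary part divisible by 8 if b is odd and by 2 in general, so κ_d has exponent two for d ≤ 3,
respectively d ≤ 1. For larger d, the absence of elements of order 4 makes S_0 of exponent two.

For the property on squares, let I represent x with (IT)² = (γ). Comparing norms gives N(γ) = g²
(`exists_norm_eq_sq`), and Cayley–Hamilton gives (γ + g)² = γ(Tr γ + 2g). Powers of 2 are then
removed from the integer factor, leaving β² = γw with w odd (`exists_odd_sq_eq_mul`); this is where
the behaviour of 2 enters. The contraction of (β) is a kernel class with the same square as x. -/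

/-! ### Splitting criteria for surjections of abelian groups. -/

theorem exists_addSection_of_ker_exponent_two {A B : Type*} [AddCommGroup A] [AddCommGroup B]
    (φ : A →+ B) (hφ : Function.Surjective φ) (hker : ∀ x ∈ φ.ker, 2 • x = 0)
    (H : ∀ x, 2 • x ∈ φ.ker → 2 • x = 0) : ∃ s : B →+ A, ∀ b, φ (s b) = b := by
  let D : AddSubgroup A := (nsmulAddMonoidHom (α := A) 2).range
  let _ : Module (ZMod 2) φ.ker := AddCommGroup.zmodModule fun x => Subtype.ext (hker x x.2)
  let _ : Module (ZMod 2) (A ⧸ D) := AddCommGroup.zmodModule fun x => by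
    obtain ⟨a, rfl⟩ := QuotientAddGroup.mk_surjective x
    rw [← QuotientAddGroup.mk_nsmul, QuotientAddGroup.eq_zero_iff]
    exact ⟨a, rfl⟩
  let f : φ.ker →+ A ⧸ D := (QuotientAddGroup.mk' D).comp φ.ker.subtype
  -- The kernel meets 2A trivially, so it embeds in the 𝔽₂-space A/2A; a linear retraction there
  -- gives a retraction r of A onto the kernel, and id - r descends to a section.
  have hf : LinearMap.ker (f.toZModLinearMap 2) = ⊥ := by
    rw [LinearMap.ker_eq_bot']
    rintro ⟨m, hm⟩ h
    obtain ⟨a, ha⟩ := (QuotientAddGroup.eq_zero_iff (N := D) m).1 h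
    have ha' : 2 • a = m := ha
    exact Subtype.ext (ha'.symm.trans (H a (ha'.symm ▸ hm)))
  obtain ⟨g, hg⟩ := LinearMap.exists_leftInverse_of_injective _ hf
  let r : A →+ A := φ.ker.subtype.comp (g.toAddMonoidHom.comp (QuotientAddGroup.mk' D))
  have hr : ∀ x ∈ φ.ker, r x = x := fun x hx =>
    congrArg Subtype.val (LinearMap.congr_fun hg ⟨x, hx⟩)
  have hrk : ∀ x, φ (r x) = 0 := fun x => (g (QuotientAddGroup.mk' D x)).2
  obtain ⟨σ, hσ⟩ := hφ.hasRightInverse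
  refine ⟨AddMonoidHom.liftOfRightInverse φ σ hσ ⟨AddMonoidHom.id A - r, fun x hx => ?_⟩,
    fun b => ?_⟩
  · simp [AddMonoidHom.mem_ker, hr x hx]
  · obtain ⟨a, rfl⟩ := hφ b
    rw [AddMonoidHom.liftOfRightInverse_comp_apply]
    simp [hrk]

theorem exists_addSection_of_exponent_two {A B : Type*} [AddCommGroup A] [AddCommGroup B]
    (φ : A →+ B) (hφ : Function.Surjective φ) (hB : ∀ b : B, 2 • b = 0)
    (H : ∀ x, 2 • x ∈ φ.ker → ∃ k ∈ φ.ker, 2 • k = 2 • x) : ∃ s : B →+ A, ∀ b, φ (s b) = b := by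
  let D : AddSubgroup A := (nsmulAddMonoidHom (α := A) 2).ker
  let _ : Module (ZMod 2) D := AddCommGroup.zmodModule fun x => Subtype.ext x.2
  let _ : Module (ZMod 2) B := AddCommGroup.zmodModule hB
  let f : D →+ B := φ.comp D.subtype
  -- Correcting lifts by kernel elements shows that A[2] already surjects onto B; a section is then
  -- chosen by linear algebra over 𝔽₂.
  have hf : LinearMap.range (f.toZModLinearMap 2) = ⊤ := by
    rw [LinearMap.range_eq_top]
    intro b
    obtain ⟨a, rfl⟩ := hφ b
    obtain ⟨k, hk, hk2⟩ := H a (by rw [AddMonoidHom.mem_ker, map_nsmul, hB])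
    refine ⟨⟨a - k, ?_⟩, ?_⟩
    · change 2 • (a - k) = 0
      rw [nsmul_sub, hk2, sub_self]
    · change φ (a - k) = φ a
      rw [map_sub, AddMonoidHom.mem_ker.1 hk, sub_zero]
  obtain ⟨g, hg⟩ := LinearMap.exists_rightInverse_of_surjective _ hf
  exact ⟨D.subtype.comp g.toAddMonoidHom, fun b => LinearMap.congr_fun hg b⟩

/-- A surjection of commutative groups splits if its kernel has exponent two or its target has
exponent two, as soon as every square in the kernel is the square of an element of the kernel. -/
theorem exists_section {A B : Type*} [CommGroup A] [CommGroup B] (φ : A →* B)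
    (hφ : Function.Surjective φ) (H : ∀ x, x ^ 2 ∈ φ.ker → ∃ k ∈ φ.ker, k ^ 2 = x ^ 2)
    (h2 : (∀ x ∈ φ.ker, x ^ 2 = 1) ∨ ∀ b : B, b ^ 2 = 1) : ∃ s : B →* A, ∀ b, φ (s b) = b := by
  rcases h2 with h2 | h2
  · obtain ⟨s, hs⟩ := exists_addSection_of_ker_exponent_two (A := Additive A) (B := Additive B)
      φ.toAdditive hφ h2 (fun x hx => by
        obtain ⟨k, hk, hk2⟩ := H x.toMul hx
        exact hk2.symm.trans (h2 k hk))
    exact ⟨AddMonoidHom.toMultiplicative s, hs⟩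
  · obtain ⟨s, hs⟩ := exists_addSection_of_exponent_two (A := Additive A) (B := Additive B)
      φ.toAdditive hφ h2 H
    exact ⟨AddMonoidHom.toMultiplicative s, hs⟩

/-! ### Powers and square roots in ℤ[ω], where ω² = a + bω. -/

section Arithmetic

variable {a b : ℤ}

theorem two_dvd_im_sq (hb : Even b) (z : QuadraticAlgebra ℤ a b) : 2 ∣ (z ^ 2).im := by
  obtain ⟨k, rfl⟩ := hb
  exact ⟨z.re * z.im + k * z.im * z.im, by rw [sq, im_mul]; ring⟩

theorem eight_dvd_im_pow_six (hb : Odd b) (z : QuadraticAlgebra ℤ a b) (hz : Odd z.norm) :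
    8 ∣ (z ^ 6).im := by
  -- With t the trace and N the norm, this is the Lucas factorisation im(z^6) = im(z) · t(t² - N)(t²
  -- - 3N). If im(z) is even, the first two factors supply 8; if it is odd, then t is odd, t² ≡ 1
  -- mod 8, and the last two do.
  have key : (z ^ 6).im = z.im * (2 * z.re + b * z.im) * ((2 * z.re + b * z.im) ^ 2 - z.norm) *
      ((2 * z.re + b * z.im) ^ 2 - 3 * z.norm) := by
    have h6 : z ^ 6 = z * z * (z * z) * (z * z) := by ring
    rw [h6, norm_def]
    simp only [im_mul, re_mul]
    ring
  rw [key]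
  rcases Int.even_or_odd z.im with hq | hq
  · have hp : Odd z.re := by
      by_contra h
      rw [Int.not_odd_iff_even] at h
      rw [norm_def, ← Int.not_even_iff_odd] at hz
      exact hz (((h.mul_right _).add (hq.mul_left _)).sub (hq.mul_left _))
    obtain ⟨k, hk⟩ := hq
    have : Even (k * (z.re + b * k)) := by
      rcases Int.even_or_odd k with h | h
      · exact h.mul_right _
      · exact (hp.add_odd (hb.mul h)).mul_left _
    obtain ⟨l, hl⟩ := this
    have : z.im * (2 * z.re + b * z.im) = 8 * l := by
      rw [hk]; linear_combination 4 * hl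
    rw [this]
    exact ((dvd_mul_right _ _).mul_right _).mul_right _
  · have hT : Odd (2 * z.re + b * z.im) := (even_two_mul _).add_odd (hb.mul hq)
    obtain ⟨j, hj⟩ := hT
    obtain ⟨l, hl⟩ := hz
    have : Even (l * (3 * l + 1)) := by
      rcases Int.even_or_odd l with h | h
      · exact h.mul_right _
      · exact (((by decide : Odd (3 : ℤ)).mul h).add_odd odd_one).mul_left _
    obtain ⟨i, hi⟩ := this
    have : Even (j * (j + 1)) := Int.even_mul_succ_self j
    obtain ⟨m, hm⟩ := this
    have h8 : ((2 * z.re + b * z.im) ^ 2 - z.norm) * ((2 * z.re + b * z.im) ^ 2 - 3 * z.norm) =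
        8 * (8 * m * m - 8 * m * l - 2 * m + i) := by
      have hsq : (2 * j + 1) ^ 2 = 8 * m + 1 := by linear_combination 4 * hm
      rw [hj, hl, hsq]; linear_combination 4 * hi
    rw [mul_assoc, h8]
    exact (dvd_mul_right _ _).mul_left _

theorem two_dvd_im_pow_six (z : QuadraticAlgebra ℤ a b) (hz : Odd z.norm) :
    2 ∣ (z ^ 6).im := by
  rcases Int.even_or_odd b with hb | hb
  · rw [show z ^ 6 = (z ^ 3) ^ 2 by ring]
    exact two_dvd_im_sq hb _
  · exact dvd_trans (by norm_num) (eight_dvd_im_pow_six hb z hz)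

theorem two_pow_dvd_im_pow (z : QuadraticAlgebra ℤ a b) (hz : Odd z.norm) (d : ℕ) :
    2 ^ (d + 1) ∣ (z ^ (6 * 2 ^ d)).im := by
  induction d with
  | zero => simpa using two_dvd_im_pow_six z hz
  | succ d ih =>
    rw [pow_succ 2 d, ← mul_assoc, pow_mul, sq, im_mul]
    obtain ⟨k, hk⟩ := ih
    rw [hk]
    exact ⟨k * ((z ^ (6 * 2 ^ d)).re + b * 2 ^ d * k), by ring⟩

/-- An element of odd norm has an odd coordinate, stated as a cancellation property modulo `4`. -/
theorem four_dvd_of_dvd_smul {z : QuadraticAlgebra ℤ a b} (hz : Odd z.norm) {w : ℤ}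
    (hre : 4 ∣ z.re * w) (him : 4 ∣ z.im * w) : 4 ∣ w := by
  have h4 : ∀ {n : ℤ}, Odd n → 4 ∣ n * w → 4 ∣ w := fun {n} hn h => by
    refine IsCoprime.dvd_of_dvd_mul_left ?_ h
    have : IsCoprime (2 : ℤ) n := (Int.prime_two.coprime_iff_not_dvd).2
      (fun h => Int.not_even_iff_odd.2 hn (even_iff_two_dvd.2 h))
    simpa using this.pow_left (m := 2)
  refine h4 hz ?_
  rw [norm_def, show (z.re * z.re + b * z.re * z.im - a * z.im * z.im) * w =
    z.re * w * (z.re + b * z.im) - z.im * w * (a * z.im) by ring]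
  exact (hre.mul_right _).sub (him.mul_right _)

/-- Descent on |w|. If 2 divides both coordinates of β, then 4 divides w because γ has odd norm, and
both can be divided out. For b odd and w even this always happens. In the other case π = ω - s
satisfies π² = 2m with m odd, and β may be divisible by π only. -/
theorem exists_odd_sq_eq_mul_of_sq_eq_mul
    (hab : Odd b ∨ ∃ s m, b = 2 * s ∧ s ^ 2 + a = 2 * m ∧ Odd m)
    {γ : QuadraticAlgebra ℤ a b} (hγ : Odd γ.norm) (n : ℕ) :
    ∀ (β : QuadraticAlgebra ℤ a b) (w : ℤ), w.natAbs = n → w ≠ 0 → β ^ 2 = γ * w →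
      ∃ (β' : QuadraticAlgebra ℤ a b) (w' : ℤ), Odd w' ∧ β' ^ 2 = γ * w' := by
  induction n using Nat.strong_induction_on with
  | _ n ih =>
  rintro β w rfl hw h
  rcases Int.even_or_odd w with hwe | hwo
  swap
  · exact ⟨β, w, hwo, h⟩
  have hre : β.re * β.re + a * β.im * β.im = γ.re * w := by
    simpa [sq] using congrArg QuadraticAlgebra.re h
  have him : β.re * β.im + β.im * β.re + b * β.im * β.im = γ.im * w := by
    simpa [sq] using congrArg QuadraticAlgebra.im h
  have halve : Even β.re → Even β.im → ∃ (β' : QuadraticAlgebra ℤ a b) (w' : ℤ),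
      Odd w' ∧ β' ^ 2 = γ * w' := by
    rintro ⟨p, hp⟩ ⟨q, hq⟩
    obtain ⟨v, rfl⟩ : 4 ∣ w := four_dvd_of_dvd_smul hγ
      ⟨p * p + a * q * q, by rw [← hre, hp, hq]; ring⟩
      ⟨p * q + q * p + b * q * q, by rw [← him, hp, hq]; ring⟩
    refine ih v.natAbs (by omega) ⟨p, q⟩ v rfl (by omega) ?_
    rw [hp, hq] at hre him
    ext
    · simp [sq]; linarith
    · simp [sq]; linarith
  rcases hab with hb | ⟨s, m, rfl, hm, hmo⟩
  · have hq : Even β.im := by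
      have : Even (b * β.im * β.im) := by
        rw [show b * β.im * β.im = γ.im * w - (β.re * β.im + β.re * β.im) by linarith]
        exact (hwe.mul_left _).sub (Even.add_self _)
      simpa [Int.even_mul, Int.not_even_iff_odd.2 hb] using this
    have hp : Even β.re := by
      have : Even (β.re * β.re) := by
        rw [show β.re * β.re = γ.re * w - a * β.im * β.im by linarith]
        exact (hwe.mul_left _).sub (hq.mul_left _)
      simpa [Int.even_mul] using this
    exact halve hp hq
  · have hu : Even (β.re + s * β.im) := by
      have : Even ((β.re + s * β.im) * (β.re + s * β.im)) := by
        rw [show (β.re + s * β.im) * (β.re + s * β.im) =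
          γ.re * w + s * (γ.im * w) + 2 * (m * β.im * β.im - a * β.im * β.im
            - s ^ 2 * β.im * β.im) by
          linear_combination hre + s * him + β.im ^ 2 * hm]
        exact ((hwe.mul_left _).add ((hwe.mul_left _).mul_left _)).add (even_two_mul _)
      simpa [Int.even_mul] using this
    rcases Int.even_or_odd β.im with hq | hq
    · exact halve (by simpa [Int.even_add, hq] using hu) hq
    · obtain ⟨v, hv⟩ := hwe
      obtain ⟨u, hu⟩ := hu
      have hvo : Odd v := by
        by_contra hve
        rw [Int.not_odd_iff_even] at hve
        obtain ⟨t, rfl⟩ := hve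
        have h1 : 2 * (m * β.im * β.im) = 4 * ((γ.re + s * γ.im) * t - u * u) := by
          have e : β.re = u + u - s * β.im := by linarith
          rw [e, hv] at hre him
          linear_combination hre + s * him - β.im ^ 2 * hm
        have h2 : Odd (m * β.im * β.im) := (hmo.mul hq).mul hq
        have h3 : Even (m * β.im * β.im) :=
          ⟨(γ.re + s * γ.im) * t - u * u, by linarith⟩
        exact Int.not_even_iff_odd.2 h2 h3
      -- Here β = 2u + β.im·π, and the witness is πβ/2 = m·β.im + uπ, whose square is γ·2m·w/4 =
      -- γvm.
      refine ⟨⟨m * β.im - s * u, u⟩, v * m, hvo.mul hmo, ?_⟩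
      have e : β.re = u + u - s * β.im := by linarith
      rw [e, hv] at hre him
      have ha : a = 2 * m - s ^ 2 := by linarith
      subst ha
      have hre' : 2 * u * u - 2 * u * s * β.im + m * β.im * β.im = γ.re * v := by linarith
      have him' : 2 * u * β.im = γ.im * v := by linarith
      ext
      · simp [sq]; linear_combination m * hre'
      · simp [sq]; linear_combination m * him'

theorem exists_odd_sq_eq_mul
    (hab : Odd b ∨ ∃ s m, b = 2 * s ∧ s ^ 2 + a = 2 * m ∧ Odd m)
    {γ : QuadraticAlgebra ℤ a b} {g : ℤ} (hg : Odd g) (hγ : γ.norm = g ^ 2) :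
    ∃ (β : QuadraticAlgebra ℤ a b) (w : ℤ), Odd w ∧ β ^ 2 = γ * w := by
  have hodd : Odd γ.norm := hγ ▸ hg.pow
  have key : ∀ g : ℤ, γ.norm = g ^ 2 → (γ + g) ^ 2 = γ * ((γ.trace + 2 * g : ℤ)) := by
    intro g hg
    rw [norm_def] at hg
    rw [trace_def]
    ext
    · simp [sq]; linear_combination -hg
    · simp [sq]; ring
  -- The sign of g is free, and Tr γ ± 2g cannot both vanish since g is odd.
  by_cases h : γ.trace + 2 * g = 0
  · refine exists_odd_sq_eq_mul_of_sq_eq_mul hab hodd _ _ _ rfl ?_ (key (-g) (by rw [hγ]; ring))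
    rintro h'
    have : g = 0 := by linarith
    simp [this] at hg
  · exact exists_odd_sq_eq_mul_of_sq_eq_mul hab hodd _ _ _ rfl h (key g hγ)

end Arithmetic

/-! ### The norm of a generator of a squared ideal. -/

section Content

variable {a b : ℤ}

theorem norm_add (x y : QuadraticAlgebra ℤ a b) :
    (x + y).norm = x.norm + y.norm + (x * star y).trace := by
  simp [norm_def, trace_def]; ring

/-- For h ≠ 0, X/h is a rational root of the monic polynomial t² - Pt + C, hence an integer. -/
theorem dvd_of_sq_eq {h X P C : ℤ} (H : X ^ 2 = h * (P * X - h * C)) : h ∣ X := by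
  have h1 : (2 * X - h * P) ^ 2 = h ^ 2 * (P ^ 2 - 4 * C) := by linear_combination 4 * H
  have h2 : h ∣ 2 * X - h * P := (Int.pow_dvd_pow_iff two_ne_zero).1 ⟨_, h1⟩
  obtain ⟨s, hs⟩ := h2
  rcases eq_or_ne h 0 with rfl | hh
  · simp at hs; simp [hs]
  have h3 : s ^ 2 = P ^ 2 - 4 * C := by
    rw [hs, mul_pow] at h1
    exact mul_left_cancel₀ (pow_ne_zero 2 hh) h1
  have h4 : Even (s ^ 2 + P ^ 2) := by
    rw [h3]; exact ⟨P ^ 2 - 2 * C, by ring⟩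
  have h5 : Even (s + P) := by
    simpa [Int.even_add, Int.even_pow] using h4
  obtain ⟨k, hk⟩ := h5
  refine ⟨k, ?_⟩
  have : 2 * X = 2 * (h * k) := by linear_combination hs + h * hk
  linarith

/-- Tr(uv) and Tr(uv̄) have sum Tr(u)Tr(v), divisible by g², and product divisible by g⁴; so
Tr(uv)/g² is integral over ℤ. -/
theorem sq_dvd_trace_mul {g : ℤ} {u v : QuadraticAlgebra ℤ a b} (hu : g ∣ u.trace)
    (hv : g ∣ v.trace) (hu' : g ^ 2 ∣ u.norm) (hv' : g ^ 2 ∣ v.norm) :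
    g ^ 2 ∣ (u * v).trace := by
  obtain ⟨A, hA⟩ := hu
  obtain ⟨B, hB⟩ := hv
  obtain ⟨C, hC⟩ := hu'
  obtain ⟨D, hD⟩ := hv'
  refine dvd_of_sq_eq (P := A * B) (C := D * (A ^ 2 - 2 * C) + C * (B ^ 2 - 2 * D)) ?_
  have key : (u * v).trace ^ 2 = u.trace * v.trace * (u * v).trace -
      (v.norm * (u.trace ^ 2 - 2 * u.norm) + u.norm * (v.trace ^ 2 - 2 * v.norm)) := by
    simp only [trace_def, norm_def, re_mul, im_mul]; ring
  rw [key, hA, hB, hC, hD]; ring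

/-- If the square of an ideal of an imaginary quadratic order is principal, then the norm of
its generator is a square. -/
theorem exists_norm_eq_sq (hab : ∀ z : QuadraticAlgebra ℤ a b, 0 ≤ z.norm)
    (J : Ideal (QuadraticAlgebra ℤ a b)) (γ : QuadraticAlgebra ℤ a b)
    (hJ : J * J = Ideal.span {γ}) : ∃ g : ℤ, γ.norm = g ^ 2 := by
  -- g generates the ideal of ℤ spanned by the norms from J. Polarisation controls traces, giving g²
  -- ∣ N(γ); conversely N(x)N(y) = N(xy) is a multiple of N(γ). Nonnegative norms fix the sign.
  obtain ⟨g, hg⟩ := (IsPrincipalIdealRing.principal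
    (Ideal.span (QuadraticAlgebra.norm '' (J : Set (QuadraticAlgebra ℤ a b))))).principal
  change _ = Ideal.span {g} at hg
  have hN : ∀ x ∈ J, g ∣ x.norm := fun x hx => by
    rw [← Ideal.mem_span_singleton, ← hg]
    exact Ideal.subset_span ⟨x, hx, rfl⟩
  have hT : ∀ x ∈ J, ∀ y ∈ J, g ∣ (x * star y).trace := fun x hx y hy => by
    have := hN _ (J.add_mem hx hy)
    rw [norm_add] at this
    exact (dvd_add_right (dvd_add (hN x hx) (hN y hy))).1 this
  have hT4 : ∀ x ∈ J, ∀ y ∈ J, ∀ x' ∈ J, ∀ y' ∈ J, g ^ 2 ∣ (x * y * star (x' * y')).trace := by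
    intro x hx y hy x' hx' y' hy'
    rw [star_mul', show x * y * (star x' * star y') = x * star x' * (y * star y') by ring]
    refine sq_dvd_trace_mul (hT x hx x' hx') (hT y hy y' hy') ?_ ?_ <;>
    · rw [map_mul, QuadraticAlgebra.norm_star, sq]
      exact mul_dvd_mul (hN _ ‹_›) (hN _ ‹_›)
  have hT' : ∀ z ∈ J * J, ∀ x' ∈ J, ∀ y' ∈ J, g ^ 2 ∣ (z * star (x' * y')).trace := by
    intro z hz x' hx' y' hy'
    refine Submodule.mul_induction_on hz (fun x hx y hy => hT4 x hx y hy x' hx' y' hy') ?_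
    intro x y hx hy
    rw [add_mul, map_add]
    exact dvd_add hx hy
  have hT2 : ∀ z ∈ J * J, ∀ z' ∈ J * J, g ^ 2 ∣ (z * star z').trace := by
    intro z hz z' hz'
    refine Submodule.mul_induction_on hz' (fun x hx y hy => hT' z hz x hx y hy) ?_
    intro x y hx hy
    rw [star_add, mul_add, map_add]
    exact dvd_add hx hy
  have hN2 : ∀ z ∈ J * J, g ^ 2 ∣ z.norm := by
    intro z hz
    induction hz using Submodule.mul_induction_on' with
    | mem_mul_mem x hx y hy =>
      rw [map_mul, sq]
      exact mul_dvd_mul (hN x hx) (hN y hy)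
    | add x hx y hy hx' hy' =>
      rw [norm_add]
      exact dvd_add (dvd_add hx' hy') (hT2 x hx y hy)
  have h1 : g ^ 2 ∣ γ.norm := hN2 γ (hJ ▸ Ideal.mem_span_singleton_self γ)
  have h2 : γ.norm ∣ g ^ 2 := by
    rw [← Ideal.span_singleton_le_span_singleton, ← Ideal.span_singleton_pow, ← hg, sq,
      Ideal.span_mul_span', Ideal.span_le]
    rintro _ ⟨_, ⟨x, hx, rfl⟩, _, ⟨y, hy, rfl⟩, rfl⟩
    have : x * y ∈ Ideal.span {γ} := hJ ▸ Ideal.mul_mem_mul hx hy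
    obtain ⟨t, ht⟩ := Ideal.mem_span_singleton.1 this
    change _ * _ ∈ Ideal.span _
    rw [Ideal.mem_span_singleton, ← map_mul, ht, map_mul]
    exact dvd_mul_right _ _
  exact ⟨g, Int.dvd_antisymm (hab γ) (sq_nonneg g) h2 h1⟩

end Content

/-! ### Ideals above 2 that detect odd norm. -/

section Parity

variable {a b : ℤ}

theorem odd_iff_cast {n : ℤ} : Odd n ↔ (n : ZMod 2) ≠ 0 := by
  rw [← Int.not_even_iff_odd, ne_eq, ZMod.intCast_zmod_eq_zero_iff_dvd, even_iff_two_dvd]; rfl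

theorem exists_ideals_odd_norm :
    ∃ P Q : Ideal (QuadraticAlgebra ℤ a b), 1 ∉ P ∧ 1 ∉ Q ∧
      (P = Q ∨ ∃ p ∈ P, ∃ q ∈ Q, p + q = 1) ∧ ∀ z, z ∉ P → z ∉ Q → Odd z.norm := by
  let f (r : ZMod 2) (h : r * r = a • 1 + b • r) : QuadraticAlgebra ℤ a b →ₐ[ℤ] ZMod 2 :=
    QuadraticAlgebra.lift ⟨r, h⟩
  have hf (r h) (z) : f r h z = z.re + z.im * r := by
    simp [f, QuadraticAlgebra.lift]
  have h1 (r h) : (1 : QuadraticAlgebra ℤ a b) ∉ RingHom.ker (f r h) := by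
    simp [RingHom.mem_ker]
  have hn (z : QuadraticAlgebra ℤ a b) : (z.norm : ZMod 2) =
      z.re * z.re + b * z.re * z.im - a * z.im * z.im := by
    rw [norm_def]; push_cast; ring
  have hz2 : ∀ x : ZMod 2, x = 0 ∨ x = 1 := by decide
  -- For b even, one map to 𝔽₂ suffices (ω ↦ a); for b odd and a even there are two, ω ↦ 0 and ω ↦
  -- 1; for a and b odd the ideal (2) is used.
  rcases hz2 b with hb | hb
  · have hr : (a : ZMod 2) * a = a • 1 + b • (a : ZMod 2) := by
      rcases hz2 a with h | h <;> simp [h, hb]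
    refine ⟨_, _, h1 a hr, h1 a hr, Or.inl rfl, fun z hz _ => ?_⟩
    rw [odd_iff_cast, hn, hb]
    rw [RingHom.mem_ker, hf] at hz
    revert hz
    generalize (z.re : ZMod 2) = x
    generalize (z.im : ZMod 2) = y
    generalize (a : ZMod 2) = a
    revert x y a
    decide
  · rcases hz2 a with ha | ha
    · have h00 : (0 : ZMod 2) * 0 = a • 1 + b • 0 := by simp [ha]
      have h11 : (1 : ZMod 2) * 1 = a • 1 + b • 1 := by simp [ha, hb]
      refine ⟨_, _, h1 0 h00, h1 1 h11, Or.inr ⟨⟨0, 1⟩, ?_, ⟨1, -1⟩, ?_, ?_⟩, fun z hz hz' => ?_⟩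
      · simp [RingHom.mem_ker, hf]
      · rw [RingHom.mem_ker, hf]; push_cast; decide
      · ext <;> simp
      · rw [odd_iff_cast, hn, hb, ha]
        rw [RingHom.mem_ker, hf] at hz hz'
        revert hz hz'
        generalize (z.re : ZMod 2) = x
        generalize (z.im : ZMod 2) = y
        revert x y
        decide
    · have key : ∀ z : QuadraticAlgebra ℤ a b, z ∉ Ideal.span {(2 : QuadraticAlgebra ℤ a b)} →
          Odd z.norm := by
        intro z hz
        rw [odd_iff_cast, hn, hb, ha]
        have hz' : ¬ ((z.re : ZMod 2) = 0 ∧ (z.im : ZMod 2) = 0) := by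
          rintro ⟨hx, hy⟩
          obtain ⟨x, hx⟩ := (ZMod.intCast_zmod_eq_zero_iff_dvd _ 2).1 hx
          obtain ⟨y, hy⟩ := (ZMod.intCast_zmod_eq_zero_iff_dvd _ 2).1 hy
          refine hz (Ideal.mem_span_singleton.2 ⟨⟨x, y⟩, ?_⟩)
          ext <;> simp [hx, hy]
        revert hz'
        generalize (z.re : ZMod 2) = x
        generalize (z.im : ZMod 2) = y
        revert x y
        decide
      have h2 : (1 : QuadraticAlgebra ℤ a b) ∉ Ideal.span {(2 : QuadraticAlgebra ℤ a b)} := by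
        intro h
        obtain ⟨t, ht⟩ := Ideal.mem_span_singleton.1 h
        have := congrArg QuadraticAlgebra.re ht
        simp at this
        omega
      exact ⟨_, _, h2, h2, Or.inl rfl, fun z hz _ => key z hz⟩

end Parity

/-! ### Representing classes by ideals containing an odd integer. -/

section Represents

variable {S : Type*} [CommRing S]

theorem algebraMap_mem_coeIdeal {s : S} {I : Ideal S} :
    algebraMap S (FractionRing S) s ∈ (I : FractionalIdeal S⁰ (FractionRing S)) ↔ s ∈ I := by
  rw [FractionalIdeal.mem_coeIdeal]
  exact ⟨fun ⟨t, ht, h⟩ => IsFractionRing.injective S (FractionRing S) h ▸ ht,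
    fun h => ⟨s, h, rfl⟩⟩

/-- Prime avoidance for an invertible fractional ideal and its inverse. -/
theorem exists_mul_notMem_of_unit (u : (FractionalIdeal S⁰ (FractionRing S))ˣ)
    {P Q : Ideal S} (hP : 1 ∉ P) (hQ : 1 ∉ Q) (hPQ : P = Q ∨ ∃ p ∈ P, ∃ q ∈ Q, p + q = 1) :
    ∃ α ∈ (u : FractionalIdeal S⁰ (FractionRing S)),
      ∃ β ∈ ((u⁻¹ : (FractionalIdeal S⁰ (FractionRing S))ˣ) : FractionalIdeal S⁰ (FractionRing S)),
      ∃ s : S, algebraMap S (FractionRing S) s = α * β ∧ s ∉ P ∧ s ∉ Q := by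
  have hint : ∀ α ∈ (u : FractionalIdeal S⁰ (FractionRing S)),
      ∀ β ∈ ((u⁻¹ : (FractionalIdeal S⁰ (FractionRing S))ˣ) :
        FractionalIdeal S⁰ (FractionRing S)),
      ∃ s : S, algebraMap S (FractionRing S) s = α * β := by
    intro α hα β hβ
    have := FractionalIdeal.mul_mem_mul hα hβ
    rwa [← Units.val_mul, mul_inv_cancel, Units.val_one, FractionalIdeal.mem_one_iff] at this
  have one (P : Ideal S) (hP : 1 ∉ P) : ∃ α ∈ (u : FractionalIdeal S⁰ (FractionRing S)),
      ∃ β ∈ ((u⁻¹ : (FractionalIdeal S⁰ (FractionRing S))ˣ) :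
        FractionalIdeal S⁰ (FractionRing S)),
      ∃ s : S, algebraMap S (FractionRing S) s = α * β ∧ s ∉ P := by
    by_contra! hcon
    have : (u : FractionalIdeal S⁰ (FractionRing S)) *
        ((u⁻¹ : (FractionalIdeal S⁰ (FractionRing S))ˣ) : FractionalIdeal S⁰ (FractionRing S)) ≤
        (P : FractionalIdeal S⁰ (FractionRing S)) := by
      rw [FractionalIdeal.mul_le]
      intro α hα β hβ
      obtain ⟨s, hs⟩ := hint α hα β hβ
      exact (FractionalIdeal.mem_coeIdeal _).2 ⟨s, hcon α hα β hβ s hs, hs⟩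
    rw [← Units.val_mul, mul_inv_cancel, Units.val_one] at this
    obtain ⟨t, ht, ht1⟩ := (FractionalIdeal.mem_coeIdeal _).1
      (this (FractionalIdeal.one_mem_one _))
    rw [map_eq_one_iff _ (IsFractionRing.injective S (FractionRing S))] at ht1
    exact hP (ht1 ▸ ht)
  rcases hPQ with rfl | ⟨p, hp, q, hq, hpq⟩
  · obtain ⟨α, hα, β, hβ, s, hs, hsP⟩ := one P hP
    exact ⟨α, hα, β, hβ, s, hs, hsP, hsP⟩
  · obtain ⟨α, hα, β, hβ, s, hs, hsP⟩ := one P hP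
    obtain ⟨α', hα', β', hβ', s', hs', hsQ⟩ := one Q hQ
    obtain ⟨t, ht⟩ := hint α hα β' hβ'
    obtain ⟨t', ht'⟩ := hint α' hα' β hβ
    have hmem (v : FractionalIdeal S⁰ (FractionRing S)) {α α'} (hα : α ∈ v) (hα' : α' ∈ v) :
        algebraMap S (FractionRing S) q * α + algebraMap S (FractionRing S) p * α' ∈ v := by
      rw [← Algebra.smul_def, ← Algebra.smul_def]
      exact Submodule.add_mem _ (Submodule.smul_mem _ _ hα) (Submodule.smul_mem _ _ hα')
    -- Chinese remaindering: since q ≡ 1 mod P and p ≡ 1 mod Q, the product is s mod P and s' mod Q.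
    refine ⟨_, hmem _ hα hα', _, hmem _ hβ hβ', q * q * s + q * p * (t + t') + p * p * s',
      ?_, fun h => hsP ?_, fun h => hsQ ?_⟩
    · simp only [map_add, map_mul, hs, hs', ht, ht']; ring
    · have e : s = (q * q * s + q * p * (t + t') + p * p * s') +
          p * ((1 + q) * s - q * (t + t') - p * s') := by
        linear_combination (-(1 + q) * s) * hpq
      rw [e]
      exact P.add_mem h (P.mul_mem_right _ hp)
    · have e : s' = (q * q * s + q * p * (t + t') + p * p * s') +
          q * ((1 + p) * s' - p * (t + t') - q * s) := by
        linear_combination (-(1 + p) * s') * hpq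
      rw [e]
      exact Q.add_mem h (Q.mul_mem_right _ hq)

variable {a b : ℤ} (e : S ≃+* QuadraticAlgebra ℤ a b)

theorem mul_conj_eq (s : S) : s * e.symm (star (e s)) = ((e s).norm : ℤ) := by
  apply e.injective
  rw [map_mul, e.apply_symm_apply, map_intCast]
  exact (algebraMap_norm_eq_mul_star (e s)).symm

include e in
theorem intCast_ne_zero_of_equiv {n : ℤ} (hn : n ≠ 0) : (n : S) ≠ 0 := by
  intro h
  apply hn
  simpa using congrArg (fun s => (e s).re) h

variable [IsDomain S]

/-- The integral ideal `I` is invertible, with class `x` in the class group. -/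
def Represents (I : Ideal S) (x : ClassGroup S) : Prop :=
  ∃ u : (FractionalIdeal S⁰ (FractionRing S))ˣ,
    (u : FractionalIdeal S⁰ (FractionRing S)) = I ∧ ClassGroup.mk (FractionRing S) u = x

namespace Represents

theorem pow {I : Ideal S} {x : ClassGroup S} (hI : Represents I x) (n : ℕ) :
    Represents (I ^ n) (x ^ n) := by
  obtain ⟨u, hu, rfl⟩ := hI
  exact ⟨u ^ n, by rw [Units.val_pow_eq_pow_val, hu, FractionalIdeal.coeIdeal_pow], map_pow _ _ _⟩

theorem eq_one_iff {I : Ideal S} {x : ClassGroup S} (hI : Represents I x) :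
    x = 1 ↔ ∃ s : S, s ≠ 0 ∧ I = Ideal.span {s} := by
  obtain ⟨u, hu, rfl⟩ := hI
  exact ClassGroup.mk_eq_one_of_coe_ideal hu

theorem eq_iff {I J : Ideal S} {x y : ClassGroup S} (hI : Represents I x) (hJ : Represents J y) :
    x = y ↔ ∃ s t : S, s ≠ 0 ∧ t ≠ 0 ∧ Ideal.span {s} * I = Ideal.span {t} * J := by
  obtain ⟨u, hu, rfl⟩ := hI
  obtain ⟨v, hv, rfl⟩ := hJ
  exact ClassGroup.mk_eq_mk_of_coe_ideal hu hv

theorem map {T : Type*} [CommRing T] [IsDomain T] [Algebra S T] [Module.IsTorsionFree S T]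
    {I : Ideal S} {x : ClassGroup S} (hI : Represents I x) :
    Represents (I.map (algebraMap S T)) (ClassGroup.extendedHom S T x) := by
  obtain ⟨u, hu, rfl⟩ := hI
  refine ⟨Units.map (FractionalIdeal.extendedHom (FractionRing T) T).toMonoidHom u, ?_,
    (ClassGroup.extendedHom_mk S T u).symm⟩
  rw [← FractionalIdeal.extendedHom_coeIdeal_eq_map (FractionRing T) T (K := FractionRing S) I,
    ← hu]
  rfl

theorem exists_of_mul_eq {I J : Ideal S} {s : S} (hs : s ≠ 0) (h : I * J = Ideal.span {s}) :
    ∃ x, Represents I x := by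
  have hs' : algebraMap S (FractionRing S) s ≠ 0 := by simpa using hs
  have : IsUnit (I : FractionalIdeal S⁰ (FractionRing S)) := by
    refine IsUnit.of_mul_eq_one ((J : FractionalIdeal S⁰ (FractionRing S)) *
      FractionalIdeal.spanSingleton S⁰ (algebraMap S (FractionRing S) s)⁻¹) ?_
    rw [← mul_assoc, ← FractionalIdeal.coeIdeal_mul, h, FractionalIdeal.coeIdeal_span_singleton,
      FractionalIdeal.spanSingleton_mul_spanSingleton, mul_inv_cancel₀ hs',
      FractionalIdeal.spanSingleton_one]
  exact ⟨_, this.unit, rfl, rfl⟩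

end Represents

include e in
theorem exists_represents (x : ClassGroup S) :
    ∃ (I J : Ideal S) (n : ℤ), Odd n ∧ (n : S) ∈ I ∧ (n : S) ∈ J ∧ I * J = Ideal.span {(n : S)} ∧
      Represents I x := by
  obtain ⟨u⟩ := x
  rw [ClassGroup.Quot_mk_eq_mk]
  obtain ⟨P, Q, hP, hQ, hPQ, hodd⟩ := exists_ideals_odd_norm (a := a) (b := b)
  obtain ⟨α, hα, β, hβ, s, hs, hsP, hsQ⟩ := exists_mul_notMem_of_unit u
    (P := P.comap e) (Q := Q.comap e) (by simpa [Ideal.mem_comap] using hP)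
    (by simpa [Ideal.mem_comap] using hQ) (by
      rcases hPQ with rfl | ⟨p, hp, q, hq, hpq⟩
      · exact Or.inl rfl
      · exact Or.inr ⟨e.symm p, by rwa [Ideal.mem_comap, e.apply_symm_apply], e.symm q,
          by rwa [Ideal.mem_comap, e.apply_symm_apply], by rw [← map_add, hpq, map_one]⟩)
  have hn : Odd (e s).norm := hodd _ hsP hsQ
  set n := (e s).norm with hndef
  have hn0 : (n : S) ≠ 0 := intCast_ne_zero_of_equiv e (by rintro h; simp [h] at hn)
  have hsn : s * e.symm (star (e s)) = n := mul_conj_eq e s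
  have hs0 : s ≠ 0 := by rintro rfl; simp at hsn; exact hn0 hsn.symm
  have hβ0 : β ≠ 0 := by
    rintro rfl
    rw [mul_zero, map_eq_zero_iff _ (IsFractionRing.injective S (FractionRing S))] at hs
    exact hs0 hs
  -- Scaling by β ∈ u⁻¹ makes the ideal integral, and it contains s = αβ, hence the odd integer n =
  -- N(s). Then J is n times the inverse.
  let v := u * toPrincipalIdeal S (FractionRing S) (Units.mk0 β hβ0)
  have hv : (v : FractionalIdeal S⁰ (FractionRing S)) =
      u * FractionalIdeal.spanSingleton S⁰ β := by simp [v]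
  have hv1 : (v : FractionalIdeal S⁰ (FractionRing S)) ≤ 1 := by
    rw [hv, ← Units.val_one, ← mul_inv_cancel u, Units.val_mul]
    gcongr
    rwa [FractionalIdeal.spanSingleton_le_iff_mem]
  obtain ⟨I, hI⟩ := FractionalIdeal.le_one_iff_exists_coeIdeal.1 hv1
  have hsI : s ∈ I := by
    rw [← algebraMap_mem_coeIdeal, hI, hv, hs]
    exact FractionalIdeal.mul_mem_mul hα (FractionalIdeal.mem_spanSingleton_self _ _)
  have hnI : (n : S) ∈ I := hsn ▸ I.mul_mem_right _ hsI
  have h1v : 1 ∈ ((v⁻¹ : (FractionalIdeal S⁰ (FractionRing S))ˣ) :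
      FractionalIdeal S⁰ (FractionRing S)) := by
    have : ((v⁻¹ : (FractionalIdeal S⁰ (FractionRing S))ˣ) :
        FractionalIdeal S⁰ (FractionRing S)) = ((u⁻¹ : (FractionalIdeal S⁰ (FractionRing S))ˣ) :
        FractionalIdeal S⁰ (FractionRing S)) * FractionalIdeal.spanSingleton S⁰ β⁻¹ := by
      simp [v, ← map_inv, mul_comm]
    rw [this, ← mul_inv_cancel₀ hβ0]
    exact FractionalIdeal.mul_mem_mul hβ (FractionalIdeal.mem_spanSingleton_self _ _)
  have hJ1 : FractionalIdeal.spanSingleton S⁰ (algebraMap S (FractionRing S) n) *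
      ((v⁻¹ : (FractionalIdeal S⁰ (FractionRing S))ˣ) :
        FractionalIdeal S⁰ (FractionRing S)) ≤ 1 := by
    rw [← Units.val_one, ← mul_inv_cancel v, Units.val_mul]
    gcongr
    rw [FractionalIdeal.spanSingleton_le_iff_mem, ← hI, algebraMap_mem_coeIdeal]
    exact hnI
  obtain ⟨J, hJ⟩ := FractionalIdeal.le_one_iff_exists_coeIdeal.1 hJ1
  refine ⟨I, J, n, hn, hnI, ?_, ?_, ?_⟩
  · rw [← algebraMap_mem_coeIdeal, hJ]
    simpa using FractionalIdeal.mul_mem_mul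
      (FractionalIdeal.mem_spanSingleton_self S⁰ (algebraMap S (FractionRing S) n)) h1v
  · rw [← FractionalIdeal.coeIdeal_inj (K := FractionRing S), FractionalIdeal.coeIdeal_mul, hI, hJ,
      FractionalIdeal.coeIdeal_span_singleton, mul_left_comm, ← Units.val_mul, mul_inv_cancel,
      Units.val_one, mul_one]
  · exact ⟨v, hI.symm, (ClassGroup.mk_eq_mk.2 ⟨_, rfl⟩).symm⟩

end Represents

/-! ### Extension and contraction away from 2. -/

section Extension

variable {R T : Type*} [CommRing R] [CommRing T] [Algebra R T]

/-- The ideal contains an odd integer. -/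
def HasOdd {S : Type*} [CommRing S] (I : Ideal S) : Prop := ∃ n : ℤ, Odd n ∧ (n : S) ∈ I

theorem HasOdd.mul {S : Type*} [CommRing S] {I J : Ideal S} (hI : HasOdd I) (hJ : HasOdd J) :
    HasOdd (I * J) := by
  obtain ⟨n, hn, hnI⟩ := hI
  obtain ⟨m, hm, hmJ⟩ := hJ
  exact ⟨n * m, hn.mul hm, by push_cast; exact Ideal.mul_mem_mul hnI hmJ⟩

theorem HasOdd.pow {S : Type*} [CommRing S] {I : Ideal S} (hI : HasOdd I) (k : ℕ) :
    HasOdd (I ^ k) := by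
  obtain ⟨n, hn, hnI⟩ := hI
  exact ⟨n ^ k, hn.pow, by push_cast; exact Ideal.pow_mem_pow hnI k⟩

theorem HasOdd.comap {J : Ideal T} (hJ : HasOdd J) : HasOdd (J.comap (algebraMap R T)) := by
  obtain ⟨n, hn, hnJ⟩ := hJ
  exact ⟨n, hn, by simpa [Ideal.mem_comap] using hnJ⟩

theorem HasOdd.map {I : Ideal R} (hI : HasOdd I) : HasOdd (I.map (algebraMap R T)) := by
  obtain ⟨n, hn, hnI⟩ := hI
  exact ⟨n, hn, by simpa using Ideal.mem_map_of_mem (algebraMap R T) hnI⟩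

variable {d : ℕ}

theorem exists_bezout_two_pow {n : ℤ} (hn : Odd n) (d : ℕ) (S : Type*) [CommRing S] :
    ∃ u v : S, u * n + v * 2 ^ d = 1 := by
  have : IsCoprime n (2 ^ d) := ((Int.prime_two.coprime_iff_not_dvd).2
      (fun h => Int.not_even_iff_odd.2 hn (even_iff_two_dvd.2 h))).symm.pow_right
  obtain ⟨u, v, h⟩ := this
  exact ⟨u, v, by exact_mod_cast congrArg (Int.cast : ℤ → S) h⟩

theorem map_comap_of_hasOdd (hc : ∀ t : T, ∃ r : R, algebraMap R T r = 2 ^ d * t)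
    {J : Ideal T} (hJ : HasOdd J) : (J.comap (algebraMap R T)).map (algebraMap R T) = J := by
  refine le_antisymm Ideal.map_comap_le fun x hx => ?_
  obtain ⟨n, hn, hnJ⟩ := hJ
  obtain ⟨u, v, huv⟩ := exists_bezout_two_pow hn d T
  obtain ⟨r, hr⟩ := hc x
  have h1 : algebraMap R T r ∈ (J.comap (algebraMap R T)).map (algebraMap R T) :=
    Ideal.mem_map_of_mem _ (by rw [Ideal.mem_comap, hr]; exact J.mul_mem_left _ hx)
  have h2 : (n : T) ∈ (J.comap (algebraMap R T)).map (algebraMap R T) := by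
    simpa using Ideal.mem_map_of_mem (algebraMap R T)
      (show (n : R) ∈ J.comap (algebraMap R T) by simpa [Ideal.mem_comap] using hnJ)
  rw [show x = u * x * n + v * algebraMap R T r by rw [hr]; linear_combination (-x) * huv]
  exact Ideal.add_mem _ (Ideal.mul_mem_left _ _ h2) (Ideal.mul_mem_left _ _ h1)

theorem comap_map_of_hasOdd (hinj : Function.Injective (algebraMap R T))
    (hc : ∀ t : T, ∃ r : R, algebraMap R T r = 2 ^ d * t)
    {I : Ideal R} (hI : HasOdd I) : (I.map (algebraMap R T)).comap (algebraMap R T) = I := by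
  refine le_antisymm (fun x hx => ?_) Ideal.le_comap_map
  obtain ⟨n, hn, hnI⟩ := hI
  obtain ⟨u, v, huv⟩ := exists_bezout_two_pow hn d R
  -- 2^d·IT lies in I, and so does n·x; Bézout for n and 2^d recovers x itself.
  have key : ∀ y ∈ I.map (algebraMap R T), ∀ t, ∃ i ∈ I, algebraMap R T i = 2 ^ d * (t * y) := by
    intro y hy
    refine Submodule.span_induction ?_ (fun t => ⟨0, I.zero_mem, by simp⟩) ?_ ?_ hy
    · rintro _ ⟨i, hi, rfl⟩ t
      obtain ⟨r, hr⟩ := hc t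
      exact ⟨r * i, I.mul_mem_left _ hi, by rw [map_mul, hr, mul_assoc]⟩
    · rintro y z _ _ hy hz t
      obtain ⟨i, hi, hi'⟩ := hy t
      obtain ⟨j, hj, hj'⟩ := hz t
      exact ⟨i + j, I.add_mem hi hj, by rw [map_add, hi', hj']; ring⟩
    · rintro s y _ hy t
      obtain ⟨i, hi, hi'⟩ := hy (t * s)
      exact ⟨i, hi, by rw [hi', smul_eq_mul, mul_assoc t]⟩
  obtain ⟨i, hi, hi'⟩ := key _ hx 1
  have : i = 2 ^ d * x := hinj (by rw [hi', one_mul, map_mul, map_pow, map_ofNat])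
  rw [show x = u * x * n + v * i by rw [this]; linear_combination (-x) * huv]
  exact I.add_mem (I.mul_mem_left _ hnI) (I.mul_mem_left _ hi)

end Extension

/-! ### The kernel of the map on class groups. -/

section Kernel

variable {R T : Type*} [CommRing R] [CommRing T] {a b a' b' : ℤ} {d : ℕ}

theorem hasOdd_span_of_odd_norm (e : T ≃+* QuadraticAlgebra ℤ a b) {β : T}
    (hβ : Odd (e β).norm) : HasOdd (Ideal.span {β}) :=
  ⟨_, hβ, mul_conj_eq e β ▸ Ideal.mul_mem_right _ _ (Ideal.mem_span_singleton_self β)⟩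

theorem odd_norm_of_hasOdd_span (e : T ≃+* QuadraticAlgebra ℤ a b) {β : T}
    (hβ : HasOdd (Ideal.span {β})) : Odd (e β).norm := by
  obtain ⟨n, hn, h⟩ := hβ
  obtain ⟨t, ht⟩ := Ideal.mem_span_singleton.1 h
  have h1 : (e β).norm * (e t).norm = n ^ 2 := by
    rw [← map_mul, ← map_mul, ← ht, map_intCast, norm_intCast, Int.cast_id]
  exact (Int.odd_mul.1 (h1 ▸ hn.pow)).1

variable [Algebra R T]

theorem exists_intCast_two_pow_mul (eT : T ≃+* QuadraticAlgebra ℤ a b)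
    (hmem : ∀ t : T, (∃ r : R, algebraMap R T r = t) ↔ 2 ^ d ∣ (eT t).im) (t : T) :
    ∃ r : R, algebraMap R T r = 2 ^ d * t := by
  rw [hmem]
  have : eT (2 ^ d * t) = ((2 ^ d : ℤ) : QuadraticAlgebra ℤ a b) * eT t := by
    rw [map_mul, map_pow, Int.cast_pow]
    congr 2
    exact map_ofNat eT 2
  rw [this, im_mul]
  simp only [re_intCast, im_intCast, Int.cast_id]
  exact ⟨(eT t).im, by ring⟩

variable [IsDomain R] [IsDomain T] [Module.IsTorsionFree R T]

theorem exists_represents_comap (eT : T ≃+* QuadraticAlgebra ℤ a b)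
    (eR : R ≃+* QuadraticAlgebra ℤ a' b')
    (hmem : ∀ t : T, (∃ r : R, algebraMap R T r = t) ↔ 2 ^ d ∣ (eT t).im)
    {J J' : Ideal T} (hJ : HasOdd J) (hJ' : HasOdd J') {n : ℤ} (hn : Odd n)
    (h : J * J' = Ideal.span {(n : T)}) :
    ∃ x, Represents (J.comap (algebraMap R T)) x := by
  have hc := exists_intCast_two_pow_mul eT hmem
  have hinj : Function.Injective (algebraMap R T) := FaithfulSMul.algebraMap_injective R T
  refine Represents.exists_of_mul_eq (J := J'.comap (algebraMap R T)) (s := (n : R))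
    (intCast_ne_zero_of_equiv eR (by rintro rfl; simp at hn)) ?_
  have hspan : HasOdd (Ideal.span {(n : R)}) := ⟨n, hn, Ideal.mem_span_singleton_self _⟩
  rw [← comap_map_of_hasOdd hinj hc (hJ.comap.mul hJ'.comap), ← comap_map_of_hasOdd hinj hc hspan,
    Ideal.map_mul, map_comap_of_hasOdd hc hJ, map_comap_of_hasOdd hc hJ', h, Ideal.map_span]
  simp

theorem extendedHom_surjective (eT : T ≃+* QuadraticAlgebra ℤ a b)
    (eR : R ≃+* QuadraticAlgebra ℤ a' b')
    (hmem : ∀ t : T, (∃ r : R, algebraMap R T r = t) ↔ 2 ^ d ∣ (eT t).im) :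
    Function.Surjective (ClassGroup.extendedHom R T) := by
  intro y
  obtain ⟨J, J', n, hn, hJ, hJ', h, hy⟩ := exists_represents eT y
  have hJo : HasOdd J := ⟨n, hn, hJ⟩
  obtain ⟨x, hx⟩ := exists_represents_comap eT eR hmem hJo ⟨n, hn, hJ'⟩ hn h
  refine ⟨x, ?_⟩
  have := hx.map (T := T)
  rw [map_comap_of_hasOdd (exists_intCast_two_pow_mul eT hmem) hJo] at this
  exact (this.eq_iff hy).2 ⟨1, 1, one_ne_zero, one_ne_zero, rfl⟩

theorem exists_generator_of_mem_ker (eT : T ≃+* QuadraticAlgebra ℤ a b)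
    {I : Ideal R} (hI : HasOdd I) {k : ClassGroup R} (hk : Represents I k)
    (hker : ClassGroup.extendedHom R T k = 1) :
    ∃ β : T, Odd (eT β).norm ∧ I.map (algebraMap R T) = Ideal.span {β} := by
  obtain ⟨β, -, hβ⟩ := hk.map.eq_one_iff.1 hker
  exact ⟨β, odd_norm_of_hasOdd_span eT (hβ ▸ hI.map), hβ⟩

theorem pow_eq_one_of_mem_ker (eT : T ≃+* QuadraticAlgebra ℤ a b)
    (eR : R ≃+* QuadraticAlgebra ℤ a' b')
    (hmem : ∀ t : T, (∃ r : R, algebraMap R T r = t) ↔ 2 ^ d ∣ (eT t).im) {m : ℕ}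
    (hm : ∀ z : QuadraticAlgebra ℤ a b, Odd z.norm → 2 ^ d ∣ (z ^ m).im)
    {k : ClassGroup R} (hker : ClassGroup.extendedHom R T k = 1) : k ^ m = 1 := by
  have hc := exists_intCast_two_pow_mul eT hmem
  have hinj : Function.Injective (algebraMap R T) := FaithfulSMul.algebraMap_injective R T
  obtain ⟨I, I', n, hn, hI, -, -, hk⟩ := exists_represents eR k
  have hIo : HasOdd I := ⟨n, hn, hI⟩
  obtain ⟨β, hβ, hβI⟩ := exists_generator_of_mem_ker eT hIo hk hker
  obtain ⟨ρ, hρ⟩ := (hmem (β ^ m)).2 (by rw [map_pow]; exact hm _ hβ)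
  -- The conjugate also lies in R, so (ρ) contains the odd integer ρρ' and is determined by its
  -- extension.
  obtain ⟨ρ', hρ'⟩ := (hmem (eT.symm (star (eT (β ^ m))))).2 (by
    rw [eT.apply_symm_apply, im_star, map_pow]; exact (hm _ hβ).neg_right)
  have hodd : Odd (eT (β ^ m)).norm := by rw [map_pow, map_pow]; exact hβ.pow
  have hprod : ρ * ρ' = ((eT (β ^ m)).norm : ℤ) := by
    apply hinj
    rw [map_mul, hρ, hρ', mul_conj_eq, map_intCast]
  have hspan : HasOdd (Ideal.span {ρ}) :=
    ⟨_, hodd, hprod ▸ Ideal.mul_mem_right _ _ (Ideal.mem_span_singleton_self ρ)⟩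
  refine (hk.pow m).eq_one_iff.2 ⟨ρ, ?_, ?_⟩
  · rintro rfl
    rw [zero_mul] at hprod
    exact intCast_ne_zero_of_equiv eR (by intro h; rw [h] at hodd; simp at hodd) hprod.symm
  · rw [← comap_map_of_hasOdd hinj hc (hIo.pow m), ← comap_map_of_hasOdd hinj hc hspan,
      Ideal.map_pow, hβI, Ideal.span_singleton_pow, Ideal.map_span, Set.image_singleton, hρ]

theorem exists_mem_ker_sq_eq (eT : T ≃+* QuadraticAlgebra ℤ a b)
    (eR : R ≃+* QuadraticAlgebra ℤ a' b')
    (hmem : ∀ t : T, (∃ r : R, algebraMap R T r = t) ↔ 2 ^ d ∣ (eT t).im)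
    (hnn : ∀ z : QuadraticAlgebra ℤ a b, 0 ≤ z.norm)
    (hab : Odd b ∨ ∃ s m, b = 2 * s ∧ s ^ 2 + a = 2 * m ∧ Odd m)
    {x : ClassGroup R} (hx : ClassGroup.extendedHom R T (x ^ 2) = 1) :
    ∃ k, ClassGroup.extendedHom R T k = 1 ∧ k ^ 2 = x ^ 2 := by
  have hc := exists_intCast_two_pow_mul eT hmem
  have hinj : Function.Injective (algebraMap R T) := FaithfulSMul.algebraMap_injective R T
  obtain ⟨I, I', n, hn, hI, -, -, hk⟩ := exists_represents eR x
  have hIo : HasOdd I := ⟨n, hn, hI⟩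
  obtain ⟨γ, hγ, hγI⟩ := exists_generator_of_mem_ker eT (hIo.pow 2) (hk.pow 2) hx
  obtain ⟨g, hg⟩ := exists_norm_eq_sq hnn ((I.map (algebraMap R T)).map eT) (eT γ) (by
    rw [← Ideal.map_mul, ← Ideal.map_mul, ← sq, hγI, Ideal.map_span, Set.image_singleton])
  have hgo : Odd g := by
    rw [hg] at hγ
    exact Int.Odd.of_mul_left (sq g ▸ hγ)
  obtain ⟨β, w, hw, hβ⟩ := exists_odd_sq_eq_mul hab hgo hg
  have hβo : Odd β.norm := by
    have : β.norm ^ 2 = (eT γ).norm * w ^ 2 := by rw [← map_pow, hβ, map_mul, norm_intCast, Int.cast_id]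
    exact Int.Odd.of_mul_left (sq β.norm ▸ this ▸ hγ.mul hw.pow)
  have hβo1 : Odd (eT (eT.symm β)).norm := by rwa [eT.apply_symm_apply]
  have hβo2 : Odd (eT (eT.symm (star β))).norm := by
    rwa [eT.apply_symm_apply, QuadraticAlgebra.norm_star]
  have hJ := hasOdd_span_of_odd_norm eT hβo1
  obtain ⟨k, hkI⟩ := exists_represents_comap eT eR hmem hJ (hasOdd_span_of_odd_norm eT hβo2) hβo (by
    rw [Ideal.span_singleton_mul_span_singleton]
    have := mul_conj_eq eT (eT.symm β)
    rw [eT.apply_symm_apply] at this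
    rw [this])
  have hmap := map_comap_of_hasOdd hc hJ
  refine ⟨k, hkI.map.eq_one_iff.2 ⟨eT.symm β, ?_, hmap⟩, ?_⟩
  · intro h
    rw [h] at hβo1
    simp at hβo1
  · refine ((hkI.pow 2).eq_iff (hk.pow 2)).2 ⟨1, w, one_ne_zero,
      intCast_ne_zero_of_equiv eR (by rintro rfl; simp at hw), ?_⟩
    have hwo : HasOdd (Ideal.span {(w : R)}) := ⟨w, hw, Ideal.mem_span_singleton_self _⟩
    rw [Ideal.span_singleton_one, Ideal.top_mul, ← comap_map_of_hasOdd hinj hc (hJ.comap.pow 2),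
      ← comap_map_of_hasOdd hinj hc (hwo.mul (hIo.pow 2)), Ideal.map_pow, hmap, Ideal.map_mul, hγI,
      Ideal.map_span, Set.image_singleton, Ideal.span_singleton_pow,
      Ideal.span_singleton_mul_span_singleton]
    congr 3
    apply eT.injective
    rw [map_pow, eT.apply_symm_apply, hβ]
    simp [mul_comm]

end Kernel

/-! ### Passing to 2-primary parts. -/

section Sylow

theorem sq_eq_one_of_pow_six {G : Type*} [Group G] {x : G} {n : ℕ} (h6 : x ^ 6 = 1)
    (h2 : x ^ 2 ^ n = 1) : x ^ 2 = 1 := by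
  have h : (x ^ 2) ^ Nat.gcd 3 (2 ^ n) = 1 :=
    pow_gcd_eq_one.2 ⟨by rw [← pow_mul, h6], by rw [← pow_mul, mul_comm, pow_mul, h2, one_pow]⟩
  rwa [Nat.Coprime.gcd_eq_one (Nat.Coprime.pow_right n (by decide)), pow_one] at h

theorem sq_eq_one_of_orderOf_ne_four {G : Type*} [Group G] (h4 : ∀ x : G, orderOf x ≠ 4) {x : G}
    {n : ℕ} (h : x ^ 2 ^ n = 1) : x ^ 2 = 1 := by
  induction n generalizing x with
  | zero => simp_all
  | succ n ih =>
    have h1 : (x ^ 2) ^ 2 ^ n = 1 := by rw [← pow_mul, ← pow_succ', h]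
    by_contra hx
    refine h4 x ?_
    rw [show 4 = 2 ^ (1 + 1) by norm_num]
    refine orderOf_eq_prime_pow (by simpa using hx) ?_
    have := ih h1
    rwa [← pow_mul] at this

theorem exists_primary_preimage {G H : Type*} [CommGroup G] [CommGroup H] {f : G →* H}
    (hf : Function.Surjective f) {m : ℕ} (hm : ∀ k, f k = 1 → k ^ (6 * 2 ^ m) = 1)
    {y : H} {j : ℕ} (hy : y ^ 2 ^ j = 1) : ∃ x, f x = y ∧ ∃ i : ℕ, x ^ 2 ^ i = 1 := by
  obtain ⟨x, rfl⟩ := hf y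
  have h3 : 3 ∣ 1 + 2 ^ (2 * j + 1) := by
    rw [pow_succ, pow_mul]
    have : 4 ^ j % 3 = 1 := by rw [Nat.pow_mod]; simp
    norm_num
    omega
  obtain ⟨c, hc⟩ := h3
  -- The exponent is 1 mod 2^j, so the image is unchanged, and divisible by 3, which removes the odd
  -- part of 6·2^m.
  refine ⟨x ^ (1 + 2 ^ (2 * j + 1)), ?_, j + m + 1, ?_⟩
  · rw [map_pow, pow_add, pow_one, show 2 * j + 1 = j + (j + 1) by ring, pow_add 2, pow_mul, hy,
      one_pow, mul_one]
  · have := hm (x ^ 2 ^ j) (by rw [map_pow, hy])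
    rw [hc, ← pow_mul, show 3 * c * 2 ^ (j + m + 1) = 2 ^ j * (6 * 2 ^ m) * c by ring, pow_mul,
      pow_mul, this, one_pow]

end Sylow

/-! ### Coordinates on the orders and the behaviour of 2. -/

section NumberField

theorem trace_quadraticAlgebra {a b : ℤ} (z : QuadraticAlgebra ℤ a b) :
    Algebra.trace ℤ (QuadraticAlgebra ℤ a b) z = z.trace := by
  rw [Algebra.trace_eq_matrix_trace (QuadraticAlgebra.basis a b), Matrix.trace_fin_two,
    Algebra.leftMulMatrix_eq_repr_mul, Algebra.leftMulMatrix_eq_repr_mul, trace_def]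
  have h0 : QuadraticAlgebra.basis a b 0 = ⟨1, 0⟩ := by
    apply (QuadraticAlgebra.basis a b).repr.injective
    ext i; fin_cases i <;> simp
  have h1 : QuadraticAlgebra.basis a b 1 = ⟨0, 1⟩ := by
    apply (QuadraticAlgebra.basis a b).repr.injective
    ext i; fin_cases i <;> simp
  simp [h0, h1]
  ring

theorem discr_quadraticAlgebra (a b : ℤ) :
    Algebra.discr ℤ (QuadraticAlgebra.basis a b) = b ^ 2 + 4 * a := by
  have h0 : QuadraticAlgebra.basis a b 0 = ⟨1, 0⟩ := by
    apply (QuadraticAlgebra.basis a b).repr.injective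
    ext i; fin_cases i <;> simp
  have h1 : QuadraticAlgebra.basis a b 1 = ⟨0, 1⟩ := by
    apply (QuadraticAlgebra.basis a b).repr.injective
    ext i; fin_cases i <;> simp
  rw [Algebra.discr_def, Matrix.det_fin_two]
  simp only [Algebra.traceMatrix_apply, Algebra.traceForm_apply, trace_quadraticAlgebra, h0, h1]
  simp [trace_def]
  ring

variable (K : Type*) [Field K] [NumberField K] [Algebra.IsQuadraticExtension ℚ K]

theorem exists_equiv_quadraticAlgebra :
    ∃ (a b : ℤ) (_ : 𝓞 K ≃ₐ[ℤ] QuadraticAlgebra ℤ a b), NumberField.discr K = b ^ 2 + 4 * a := by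
  have hrank : Module.finrank ℤ (𝓞 K) = 2 := by
    rw [NumberField.RingOfIntegers.rank, Algebra.IsQuadraticExtension.finrank_eq_two]
  let v := Module.finBasisOfFinrankEq ℤ (𝓞 K) hrank
  have hrepr (z : 𝓞 K) : z = v.repr z 0 * v 0 + v.repr z 1 * v 1 := by
    conv_lhs => rw [← v.sum_repr z, Fin.sum_univ_two, zsmul_eq_mul, zsmul_eq_mul]
  have hindep (p q : ℤ) (h : (p : 𝓞 K) * v 0 + q * v 1 = 0) : p = 0 ∧ q = 0 := by
    have := Fintype.linearIndependent_iff.1 v.linearIndependent ![p, q]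
      (by simpa [Fin.sum_univ_two, zsmul_eq_mul] using h)
    exact ⟨this 0, this 1⟩
  have h1 := hrepr 1
  set x := v.repr 1 0
  set y := v.repr 1 1
  -- The gcd of the coordinates of 1 divides 1, so 1 extends to a basis (1, θ).
  have hcop : IsCoprime x y := by
    rw [Int.isCoprime_iff_gcd_eq_one, ← Nat.isUnit_iff, ← Int.ofNat_isUnit]
    obtain ⟨x', hx'⟩ := Int.gcd_dvd_left x y
    obtain ⟨y', hy'⟩ := Int.gcd_dvd_right x y
    have hu : IsUnit (algebraMap ℤ (𝓞 K) (Int.gcd x y)) := by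
      refine IsUnit.of_mul_eq_one (x' * v 0 + y' * v 1) ?_
      have hx := congrArg (Int.cast : ℤ → 𝓞 K) hx'
      have hy := congrArg (Int.cast : ℤ → 𝓞 K) hy'
      push_cast at hx hy
      rw [eq_intCast, Int.cast_natCast]
      linear_combination -h1 - v 0 * hx - v 1 * hy
    have := hu.map (Algebra.norm ℤ)
    rw [Algebra.norm_algebraMap_of_basis v, Fintype.card_fin] at this
    exact (isUnit_pow_iff two_ne_zero).1 this
  obtain ⟨u, w, huw⟩ := hcop
  have huw' : (u : 𝓞 K) * x + w * y = 1 := by exact_mod_cast congrArg (Int.cast : ℤ → 𝓞 K) huw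
  let θ : 𝓞 K := -w * v 0 + u * v 1
  have hv0 : v 0 = u - y * θ := by
    simp only [θ]; linear_combination -v 0 * huw' - u * h1
  have hv1 : v 1 = w + x * θ := by
    simp only [θ]; linear_combination -v 1 * huw' - w * h1
  have hspan (z : 𝓞 K) : ∃ p q : ℤ, z = p + q * θ := by
    refine ⟨v.repr z 0 * u + v.repr z 1 * w, v.repr z 1 * x - v.repr z 0 * y, ?_⟩
    conv_lhs => rw [hrepr z, hv0, hv1]
    push_cast
    ring
  obtain ⟨a, b, hab⟩ := hspan (θ * θ)
  let f : QuadraticAlgebra ℤ a b →ₐ[ℤ] 𝓞 K :=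
    QuadraticAlgebra.lift ⟨θ, by rw [hab]; simp [zsmul_eq_mul]⟩
  have hf (z) : f z = z.re + z.im * θ := by
    simp [f, QuadraticAlgebra.lift, zsmul_eq_mul]
  have hbij : Function.Bijective f := by
    constructor
    · rw [injective_iff_map_eq_zero]
      intro z hz
      rw [hf] at hz
      obtain ⟨e1, e2⟩ := hindep (z.re * x - z.im * w) (z.re * y + z.im * u) (by
        push_cast
        rw [← hz]
        simp only [θ]
        linear_combination -(z.re : 𝓞 K) * h1)
      ext
      · change z.re = 0
        linear_combination -z.re * huw + u * e1 + w * e2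
      · change z.im = 0
        linear_combination -z.im * huw + x * e2 - y * e1
    · intro z
      obtain ⟨p, q, rfl⟩ := hspan z
      exact ⟨⟨p, q⟩, hf _⟩
  let E := AlgEquiv.ofBijective f hbij
  refine ⟨a, b, E.symm, ?_⟩
  rw [← discr_quadraticAlgebra, Algebra.discr_eq_discr_of_algEquiv _ E,
    ← NumberField.discr_eq_discr K ((QuadraticAlgebra.basis a b).map E.toLinearEquiv)]
  rfl

theorem discr_neg [NumberField.IsTotallyComplex K] : NumberField.discr K < 0 := by
  have h := NumberField.InfinitePlace.card_add_two_mul_card_eq_rank K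
  rw [NumberField.nrRealPlaces_eq_zero_iff.2 inferInstance,
    Algebra.IsQuadraticExtension.finrank_eq_two] at h
  have h1 : NumberField.InfinitePlace.nrComplexPlaces K = 1 := by omega
  rw [← Int.sign_eq_neg_one_iff_neg, NumberField.sign_discr, h1, pow_one]

theorem norm_nonneg_of_discr_neg {a b : ℤ} (h : b ^ 2 + 4 * a < 0) (z : QuadraticAlgebra ℤ a b) :
    0 ≤ z.norm := by
  rw [norm_def]
  nlinarith [sq_nonneg (2 * z.re + b * z.im), sq_nonneg z.im,
    mul_nonneg (neg_nonneg.2 h.le) (sq_nonneg z.im)]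

variable {K} in
omit [NumberField K] [Algebra.IsQuadraticExtension ℚ K] in
theorem exists_equiv_order {a b : ℤ} (E : 𝓞 K ≃ₐ[ℤ] QuadraticAlgebra ℤ a b) {n : ℕ} (hn : n ≠ 0) :
    ∃ e : order K n ≃+* QuadraticAlgebra ℤ (n ^ 2 * a) (n * b),
      ∀ x : order K n, E x = ⟨(e x).re, n * (e x).im⟩ := by
  let f : QuadraticAlgebra ℤ (n ^ 2 * a) (n * b) →ₐ[ℤ] QuadraticAlgebra ℤ a b :=
    QuadraticAlgebra.lift ⟨⟨0, n⟩, by ext <;> simp [sq, mul_comm, mul_left_comm]⟩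
  have hf (z) : f z = ⟨z.re, n * z.im⟩ := by
    ext <;> simp [f, QuadraticAlgebra.lift, mul_comm]
  have hmem (z) : E.symm (f z) ∈ order K n := by
    refine ⟨z.re, E.symm ⟨0, z.im⟩, ?_⟩
    apply E.injective
    rw [AlgEquiv.apply_symm_apply, hf]
    ext <;> simp
  let g : QuadraticAlgebra ℤ (n ^ 2 * a) (n * b) →+* order K n :=
    ((E.symm : _ →+* 𝓞 K).comp (f : _ →+* QuadraticAlgebra ℤ a b)).codRestrict (order K n) hmem
  have hg (z) : ((g z : order K n) : 𝓞 K) = E.symm (f z) := rfl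
  have hbij : Function.Bijective g := by
    constructor
    · intro z z' h
      have h' : f z = f z' := E.symm.injective (congrArg Subtype.val h)
      rw [hf, hf, QuadraticAlgebra.mk.injEq] at h'
      ext
      · exact h'.1
      · simpa [hn] using h'.2
    · rintro ⟨_, p, y, rfl⟩
      refine ⟨⟨p + n * (E y).re, (E y).im⟩, Subtype.ext (E.injective ?_)⟩
      rw [hg, AlgEquiv.apply_symm_apply, hf]
      ext <;> simp
  refine ⟨(RingEquiv.ofBijective g hbij).symm, fun x => ?_⟩
  obtain ⟨z, rfl⟩ := hbij.2 x
  rw [hg, AlgEquiv.apply_symm_apply, hf]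
  have : (RingEquiv.ofBijective g hbij).symm (g z) = z :=
    (RingEquiv.ofBijective g hbij).symm_apply_apply z
  rw [this]

/-- If b is even, θ = a + ω has θ² ∈ 2T but θ ∉ 2T, so (2) is not prime. Every prime containing 2
then contains θ, which determines it, so two distinct ones cannot exist. -/
theorem odd_of_isSplitIn_or_isInertIn {T : Type*} [CommRing T] {a b : ℤ}
    (e : T ≃+* QuadraticAlgebra ℤ a b) (h : IsSplitIn 2 T ∨ IsInertIn 2 T) : Odd b := by
  by_contra hb
  rw [Int.not_odd_iff_even] at hb
  obtain ⟨s, rfl⟩ := hb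
  obtain ⟨k, hk⟩ := Int.even_mul_succ_self a
  let θ : T := e.symm ⟨a, 1⟩
  have hθ : θ * θ = 2 * e.symm ⟨k, s + a⟩ := by
    apply e.injective
    simp only [θ, map_mul, e.apply_symm_apply]
    rw [show e 2 = 2 from map_ofNat e 2]
    ext
    · simp; linear_combination hk
    · simp; ring
  rcases h with ⟨P, Q, hP, hQ, hne, h⟩ | h
  · have h2 : ((2 : ℕ) : T) ∈ P * Q := h.le (Ideal.mem_span_singleton_self _)
    rw [Nat.cast_ofNat] at h2
    have key (P : Ideal T) (hP : P.IsPrime) (h2 : (2 : T) ∈ P) (z : T) :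
        z ∈ P ↔ Even ((e z).re - (e z).im * a) := by
      have hθP : θ ∈ P := by
        refine (hP.mem_or_mem (?_ : θ * θ ∈ P)).elim id id
        rw [hθ]
        exact P.mul_mem_right _ h2
      have hz : z = (((e z).re - (e z).im * a : ℤ) : T) + ((e z).im : T) * θ := by
        apply e.injective
        rw [map_add, map_mul, map_intCast, map_intCast, e.apply_symm_apply]
        ext <;> simp
      have hz' : z ∈ P ↔ (((e z).re - (e z).im * a : ℤ) : T) ∈ P := by
        conv_lhs => rw [hz]
        exact P.add_mem_iff_left (P.mul_mem_left _ hθP)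
      rw [hz']
      generalize (e z).re - (e z).im * a = n
      constructor
      · intro hn
        by_contra ho
        rw [Int.not_even_iff_odd] at ho
        obtain ⟨m, rfl⟩ := ho
        refine hP.one_notMem ?_
        rw [show (1 : T) = ((2 * m + 1 : ℤ) : T) - 2 * m by push_cast; ring]
        exact P.sub_mem hn (P.mul_mem_right _ h2)
      · rintro ⟨m, rfl⟩
        rw [show ((m + m : ℤ) : T) = 2 * m by push_cast; ring]
        exact P.mul_mem_right _ h2
    refine hne (Ideal.ext fun z => ?_)
    rw [key P hP (Ideal.mul_le_inf h2).1, key Q hQ (Ideal.mul_le_inf h2).2]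
  · have hmem : θ ∈ Ideal.span {((2 : ℕ) : T)} := by
      refine (h.mem_or_mem (?_ : θ * θ ∈ _)).elim id id
      rw [hθ, Ideal.mem_span_singleton]
      exact ⟨_, by rw [Nat.cast_ofNat]⟩
    obtain ⟨t, ht⟩ := Ideal.mem_span_singleton.1 hmem
    have := congrArg (fun z => (e z).im) ht
    simp only [θ, map_mul, e.apply_symm_apply, map_natCast] at this
    simp at this
    omega

theorem exists_of_discr_mod {a b : ℤ} (h : b ^ 2 + 4 * a ≡ 8 [ZMOD 16]) :
    ∃ s m, b = 2 * s ∧ s ^ 2 + a = 2 * m ∧ Odd m := by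
  obtain ⟨k, hk⟩ := h.symm.dvd
  have hb : Even b := by
    have : Even (b ^ 2) := ⟨8 * k + 4 - 2 * a, by linarith⟩
    simpa [Int.even_pow] using this
  obtain ⟨s, rfl⟩ := hb
  refine ⟨s, 2 * k + 1, by ring, by linarith, ⟨k, rfl⟩⟩

end NumberField

/-! ### Assembling the split exact sequence. -/

theorem isSplitSES_of_exists_section {K : Type*} [Field K] {ℓ c d : ℕ}
    (hsurj : Function.Surjective (phi K ℓ c d))
    (h : ∃ s : sylowPart K ℓ c →* sylowPart K ℓ (c * ℓ ^ d), ∀ y, phi K ℓ c d (s y) = y) :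
    IsSplitSES K ℓ c d := by
  obtain ⟨s, hs⟩ := h
  exact ⟨{  inl := (kappa K ℓ c d).subtype
            rightHom := phi K ℓ c d
            inl_injective := Subtype.val_injective
            range_inl_eq_ker_rightHom := Subgroup.range_subtype _
            rightHom_surjective := hsurj }, rfl, rfl, ⟨⟨s, hs⟩⟩⟩

variable {K : Type*} [Field K] {c d : ℕ} {a b a' b' : ℤ}

theorem isSplitSES_of_quadraticAlgebra
    (eT : order K c ≃+* QuadraticAlgebra ℤ a b)
    (eR : order K (c * 2 ^ d) ≃+* QuadraticAlgebra ℤ a' b')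
    (hmem : ∀ t : order K c,
      (∃ r : order K (c * 2 ^ d), (r : 𝓞 K) = t) ↔ 2 ^ d ∣ (eT t).im)
    (hnn : ∀ z : QuadraticAlgebra ℤ a b, 0 ≤ z.norm)
    (hab : Odd b ∨ ∃ s m, b = 2 * s ∧ s ^ 2 + a = 2 * m ∧ Odd m)
    (hd : (∀ z : QuadraticAlgebra ℤ a b, Odd z.norm → 2 ^ d ∣ (z ^ 6).im) ∨
      ∀ x : ClassGroup (order K c), orderOf x ≠ 4) :
    IsSplitSES K 2 c d := by
  let _ : Algebra (order K (c * 2 ^ d)) (order K c) :=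
    (Subring.inclusion (order_le_order K (Dvd.intro (2 ^ d) rfl))).toAlgebra
  have _ : Module.IsTorsionFree (order K (c * 2 ^ d)) (order K c) :=
    Module.isTorsionFree_iff_algebraMap_injective.2 (Subring.inclusion_injective _)
  have hmem' : ∀ t : order K c, (∃ r : order K (c * 2 ^ d),
      algebraMap (order K (c * 2 ^ d)) (order K c) r = t) ↔ 2 ^ d ∣ (eT t).im := fun t => by
    rw [← hmem]
    exact exists_congr fun r => Subtype.ext_iff
  have hphi (x : sylowPart K 2 (c * 2 ^ d)) : (phi K 2 c d x : ClassGroup (order K c)) =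
      ClassGroup.extendedHom (order K (c * 2 ^ d)) (order K c) x := rfl
  have hker (x : sylowPart K 2 (c * 2 ^ d)) : x ∈ (phi K 2 c d).ker ↔
      ClassGroup.extendedHom (order K (c * 2 ^ d)) (order K c) x = 1 := by
    rw [MonoidHom.mem_ker, ← hphi, OneMemClass.coe_eq_one]
  have hsurj : Function.Surjective (phi K 2 c d) := by
    rintro ⟨y, j, hj⟩
    obtain ⟨x, hx, hx2⟩ := exists_primary_preimage (extendedHom_surjective eT eR hmem')
      (fun k hk => pow_eq_one_of_mem_ker eT eR hmem' (m := 6 * 2 ^ d)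
        (fun z hz => (pow_dvd_pow 2 d.le_succ).trans (two_pow_dvd_im_pow z hz d)) hk) hj
    exact ⟨⟨x, hx2⟩, Subtype.ext hx⟩
  refine isSplitSES_of_exists_section hsurj (exists_section _ hsurj ?_ ?_)
  · rintro x hx
    rw [hker] at hx
    obtain ⟨k, hk, hk2⟩ := exists_mem_ker_sq_eq eT eR hmem' hnn hab hx
    obtain ⟨i, hi⟩ := x.2
    have hk' : k ∈ sylowPart K 2 (c * 2 ^ d) := ⟨i + 1, by
      rw [pow_succ', pow_mul, hk2, pow_right_comm, hi, one_pow]⟩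
    exact ⟨⟨k, hk'⟩, (hker _).2 hk, Subtype.ext hk2⟩
  · rcases hd with hd | hd
    · refine Or.inl fun x hx => Subtype.ext ?_
      obtain ⟨i, hi⟩ := x.2
      exact sq_eq_one_of_pow_six (pow_eq_one_of_mem_ker eT eR hmem' hd ((hker x).1 hx)) hi
    · refine Or.inr fun y => Subtype.ext ?_
      obtain ⟨i, hi⟩ := y.2
      exact sq_eq_one_of_orderOf_ne_four hd hi

end QuadraticOrder

theorem mainTheorem11 (K : Type*) [Field K] [NumberField K]
    [Algebra.IsQuadraticExtension ℚ K] [NumberField.IsTotallyComplex K]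
    (c : ℕ) (hc : Odd c) (d : ℕ) :
    ((QuadraticOrder.IsSplitIn 2 (QuadraticOrder.order K c) ∨
        QuadraticOrder.IsInertIn 2 (QuadraticOrder.order K c)) →
      (d ≤ 3 ∨ (3 < d ∧ ∀ x : ClassGroup (QuadraticOrder.order K c), orderOf x ≠ 4)) →
      QuadraticOrder.IsSplitSES K 2 c d) ∧
    (QuadraticOrder.IsRamifiedIn 2 (QuadraticOrder.order K c) →
      NumberField.discr K ≡ 8 [ZMOD 16] →
      (d ≤ 1 ∨ (1 < d ∧ ∀ x : ClassGroup (QuadraticOrder.order K c), orderOf x ≠ 4)) →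
      QuadraticOrder.IsSplitSES K 2 c d) := by
  have hc0 : c ≠ 0 := by rintro rfl; simp at hc
  obtain ⟨a, b, E, hD⟩ := QuadraticOrder.exists_equiv_quadraticAlgebra K
  obtain ⟨eT, hT⟩ := QuadraticOrder.exists_equiv_order E hc0
  obtain ⟨eR, hR⟩ := QuadraticOrder.exists_equiv_order E (n := c * 2 ^ d) (by positivity)
  have hdisc : ((c : ℤ) * b) ^ 2 + 4 * ((c : ℤ) ^ 2 * a) = c ^ 2 * NumberField.discr K := by
    rw [hD]; ring
  have hnn := QuadraticOrder.norm_nonneg_of_discr_neg (a := (c : ℤ) ^ 2 * a) (b := c * b) (by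
    rw [hdisc]
    exact mul_neg_of_pos_of_neg (by positivity) (QuadraticOrder.discr_neg K))
  have hmem : ∀ t : QuadraticOrder.order K c,
      (∃ r : QuadraticOrder.order K (c * 2 ^ d), (r : 𝓞 K) = t) ↔ 2 ^ d ∣ (eT t).im := by
    intro t
    constructor
    · rintro ⟨r, hr⟩
      have h := hT t
      rw [← hr, hR, QuadraticAlgebra.mk.injEq] at h
      refine ⟨(eR r).im, mul_left_cancel₀ (Nat.cast_ne_zero.2 hc0 : (c : ℤ) ≠ 0) ?_⟩
      rw [← h.2]
      push_cast
      ring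
    · rintro ⟨q, hq⟩
      refine ⟨eR.symm ⟨(eT t).re, q⟩, E.injective ?_⟩
      rw [hR, hT, eR.apply_symm_apply, hq]
      push_cast
      rw [mul_assoc]
  refine ⟨fun h hd => ?_, fun _ h hd => ?_⟩
  · have hb := QuadraticOrder.odd_of_isSplitIn_or_isInertIn eT h
    refine QuadraticOrder.isSplitSES_of_quadraticAlgebra eT eR hmem hnn (Or.inl hb) ?_
    exact hd.imp (fun hd z hz => (pow_dvd_pow 2 hd).trans
      (QuadraticOrder.eight_dvd_im_pow_six hb z hz)) And.right
  -- The order of conductor c has discriminant c²D_K, and c² ≡ 1 mod 8 preserves the class 8 mod 16.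
  · have hmod : ((c : ℤ) * b) ^ 2 + 4 * ((c : ℤ) ^ 2 * a) ≡ 8 [ZMOD 16] := by
      obtain ⟨k, hk⟩ := Int.eight_dvd_sq_sub_one_of_odd (k := c) (by exact_mod_cast hc)
      obtain ⟨l, hl⟩ := h.symm.dvd
      rw [hdisc, show (c : ℤ) ^ 2 = 8 * k + 1 by linarith,
        show NumberField.discr K = 16 * l + 8 by linarith]
      exact (Int.modEq_iff_dvd.2 ⟨8 * k * l + 4 * k + l, by ring⟩).symm
    refine QuadraticOrder.isSplitSES_of_quadraticAlgebra eT eR hmem hnn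
      (Or.inr (QuadraticOrder.exists_of_discr_mod hmod)) ?_
    exact hd.imp (fun hd z hz => (pow_dvd_pow 2 hd).trans
      (by rw [pow_one]; exact QuadraticOrder.two_dvd_im_pow_six z hz)) And.right
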